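/- Let $F$ be a free group (of any rank, finite or infinite) and let $x\in F$; if $F$ is infinite cyclic, assume in addition that $x\neq 1$. Call $x$ separable if $F=F_1\ast F_2$ for some nontrivial subgroups $F_1,F_2\le F$ such that $x$ is conjugate in $F$ to an element of $F_1$ or of $F_2$. For a free basis $B$ of $F$, let $w_1w_2\cdots w_n$ (with $w_i\in B\cup B^{-1}$) be a cyclically reduced word in $B$ representing a conjugate of $x$; it is unique up to cyclic permutation. The Whitehead graph $Wh_B(x)$ has vertex set $B\sqcup B^{-1}$ and, for each $i=1,\dots,n$, an edge joining $w_i$ to $w_{i+1}^{-1}$, where $w_{n+1}:=w_1$. A graph is called disconnected if it has two vertices that are not joined by a path (so the empty graph is not disconnected), and a vertex $v$ is called a cut-vertex if removing $v$ increases the number of connected components. Then $x$ is separable if and only if, for every free basis $B$ of $F$, the graph $Wh_B(x)$ is disconnected or has a cut-vertex. -/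

import Mathlib

universe u

/-- `F` is the internal free product `F₁ ∗ F₂` of its subgroups `F₁` and `F₂`: the canonical
homomorphism from the free product to `F` is an isomorphism. -/
def IsInternalFreeProduct {F : Type*} [Group F] (F₁ F₂ : Subgroup F) : Prop :=
  Function.Bijective (Monoid.Coprod.lift F₁.subtype F₂.subtype)

/-- A finite subset `A` of `F` is separable if `F = F₁ ∗ F₂` with both factors nontrivial, so that
every element of `A` is conjugate to an element of `F₁` or to an element of `F₂`. -/
def IsSeparableSet {F : Type*} [Group F] (A : Finset F) : Prop :=
  ∃ F₁ F₂ : Subgroup F, F₁ ≠ ⊥ ∧ F₂ ≠ ⊥ ∧ IsInternalFreeProduct F₁ F₂ ∧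
    ∀ a ∈ A, (∃ g : F, g * a * g⁻¹ ∈ F₁) ∨ (∃ g : F, g * a * g⁻¹ ∈ F₂)

open Classical in
/-- A cyclically reduced word in the basis `B` that represents a conjugate of `x` (it is unique up
to cyclic permutation). The letter `(i, true)` stands for `B i`, and `(i, false)` for `(B i)⁻¹`. -/
noncomputable def cyclicWord {F ι : Type*} [Group F] (B : FreeGroupBasis ι F) (x : F) :
    List (ι × Bool) :=
  FreeGroup.reduceCyclically (B.repr x).toWord

/-- The Whitehead graph of `x` with respect to the basis `B`. There are two vertices for each basis
element `B i`, namely `(i, true)`, labelled `B i`, and `(i, false)`, labelled `(B i)⁻¹`. For each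
pair `w₁ w₂` of cyclically consecutive letters of the cyclically reduced word of `x` there is an
edge between `w₁` and `w₂⁻¹`. Multiplicities of edges are not recorded; there are no loops, since
the word is cyclically reduced. -/
noncomputable def whiteheadGraph {F ι : Type*} [Group F] (B : FreeGroupBasis ι F) (x : F) :
    SimpleGraph (ι × Bool) :=
  SimpleGraph.fromRel fun u v =>
    (u, (v.1, !v.2)) ∈ (cyclicWord B x).zip ((cyclicWord B x).rotate 1)

/-- A vertex `v` is a cut-vertex of `G` if removing `v` (with its edges) leaves a graph with more
connected components than `G`. -/
def IsCutVertex {V : Type*} (G : SimpleGraph V) (v : V) : Prop :=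
  Cardinal.mk G.ConnectedComponent < Cardinal.mk (G.induce {v}ᶜ).ConnectedComponent

/-! ### Free products and free bases -/

section FreeProduct

variable {F : Type*} [Group F]

/-! If every basis gives a disconnected graph or a cut-vertex, take a basis in which the cyclic word
of `x` is shortest. Suppose its graph is connected with cut-vertex `v`, and let `A` consist of `v`
and the components of the graph minus `v` that miss `v⁻¹`. The Whitehead automorphism along `A`
removes one letter for each edge at `v` and adds at most one for each edge leaving `A`; the latter
edges all end at `v`, and some edge at `v` stays inside `A`, so the word gets shorter
(`exists_shorter_basis`), a contradiction. Hence the graph is disconnected. A component that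
separates some `v` from `v⁻¹` would also shorten the word unless `v` and `v⁻¹` are absent from it;
otherwise the component is closed under inversion. Either way the basis splits into two classes,
only one of which the word uses (`isSeparableSet_of_not_preconnected`); both are nonempty unless `x
= 1` in an infinite cyclic group.

Conversely, a splitting `F₁ ∗ F₂` separates ends of `F`: it yields an almost right invariant
function `P` that is not almost constant but agrees at both ends of each axis of a conjugate of `x`
(`IsInternalFreeProduct.exists_almostInvariant`). In a connected graph without cut-vertex, each edge
is an axis joining two neighbouring cones of the Cayley tree, so the limits of `P` on cones
coincide, by induction from long prefixes down to the empty one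
(`exists_eventually_eq_of_preconnected`). Then `P` is almost constant, a contradiction. -/

theorem FreeGroupBasis.closure_range {ι : Type*} (B : FreeGroupBasis ι F) :
    Subgroup.closure (Set.range B) = ⊤ := by
  have h : Set.range B = B.repr.symm.toMonoidHom '' Set.range FreeGroup.of := by
    rw [← Set.range_comp]; rfl
  rw [h, ← MonoidHom.map_closure, FreeGroup.closure_range_of, ← MonoidHom.range_eq_map]
  exact MonoidHom.range_eq_top.2 B.repr.symm.surjective

/-- A partition of a free basis splits the free group as a free product. -/
theorem FreeGroupBasis.isInternalFreeProduct_closure {ι : Type*} (B : FreeGroupBasis ι F)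
    (S : Set ι) :
    IsInternalFreeProduct (Subgroup.closure (B '' S)) (Subgroup.closure (B '' Sᶜ)) := by
  classical
  set F₁ := Subgroup.closure (B '' S) with hF₁
  set F₂ := Subgroup.closure (B '' Sᶜ) with hF₂
  have m₁ : ∀ i, i ∈ S → B i ∈ F₁ := fun i hi => Subgroup.subset_closure ⟨i, hi, rfl⟩
  have m₂ : ∀ i, i ∉ S → B i ∈ F₂ := fun i hi => Subgroup.subset_closure ⟨i, hi, rfl⟩
  -- A left inverse of the canonical map, which proves injectivity.
  let ψ : F →* Monoid.Coprod F₁ F₂ := B.lift fun i =>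
    if h : i ∈ S then Monoid.Coprod.inl ⟨B i, m₁ i h⟩ else Monoid.Coprod.inr ⟨B i, m₂ i h⟩
  have hψ : ∀ i, ψ (B i) = if h : i ∈ S then Monoid.Coprod.inl ⟨B i, m₁ i h⟩
      else Monoid.Coprod.inr ⟨B i, m₂ i h⟩ := fun i => by simp [ψ]
  constructor
  · have e₁ : ψ.comp F₁.subtype = Monoid.Coprod.inl := by
      ext ⟨y, hy⟩
      induction hy using Subgroup.closure_induction with
      | mem y h =>
        obtain ⟨i, hi, rfl⟩ := h
        simp [hψ, hi]
      | one => exact (map_one ψ).trans (map_one Monoid.Coprod.inl).symm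
      | mul a b ha hb h1 h2 =>
        have h1' : ψ a = Monoid.Coprod.inl ⟨a, ha⟩ := h1
        have h2' : ψ b = Monoid.Coprod.inl ⟨b, hb⟩ := h2
        change ψ (a * b) = Monoid.Coprod.inl (⟨a, ha⟩ * ⟨b, hb⟩)
        rw [map_mul, map_mul, h1', h2']
      | inv a ha h1 =>
        have h1' : ψ a = Monoid.Coprod.inl ⟨a, ha⟩ := h1
        change ψ a⁻¹ = Monoid.Coprod.inl (⟨a, ha⟩⁻¹)
        rw [map_inv, map_inv, h1']
    have e₂ : ψ.comp F₂.subtype = Monoid.Coprod.inr := by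
      ext ⟨y, hy⟩
      induction hy using Subgroup.closure_induction with
      | mem y h =>
        obtain ⟨i, hi, rfl⟩ := h
        have hi' : i ∉ S := hi
        simp [hψ, hi']
      | one => exact (map_one ψ).trans (map_one Monoid.Coprod.inr).symm
      | mul a b ha hb h1 h2 =>
        have h1' : ψ a = Monoid.Coprod.inr ⟨a, ha⟩ := h1
        have h2' : ψ b = Monoid.Coprod.inr ⟨b, hb⟩ := h2
        change ψ (a * b) = Monoid.Coprod.inr (⟨a, ha⟩ * ⟨b, hb⟩)
        rw [map_mul, map_mul, h1', h2']
      | inv a ha h1 =>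
        have h1' : ψ a = Monoid.Coprod.inr ⟨a, ha⟩ := h1
        change ψ a⁻¹ = Monoid.Coprod.inr (⟨a, ha⟩⁻¹)
        rw [map_inv, map_inv, h1']
    have e : ψ.comp (Monoid.Coprod.lift F₁.subtype F₂.subtype) = MonoidHom.id _ := by
      apply Monoid.Coprod.hom_ext
      · rw [MonoidHom.comp_assoc, Monoid.Coprod.lift_comp_inl, e₁]; rfl
      · rw [MonoidHom.comp_assoc, Monoid.Coprod.lift_comp_inr, e₂]; rfl
    exact Function.LeftInverse.injective (g := ψ) fun y => DFunLike.congr_fun e y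
  · rw [← MonoidHom.range_eq_top, Monoid.Coprod.range_lift, Subgroup.range_subtype,
      Subgroup.range_subtype, hF₁, hF₂, ← Subgroup.closure_union, ← Set.image_union,
      Set.union_compl_self, Set.image_univ, B.closure_range]

theorem IsInternalFreeProduct.sup_eq_top {F₁ F₂ : Subgroup F} (h : IsInternalFreeProduct F₁ F₂) :
    F₁ ⊔ F₂ = ⊤ := by
  have := MonoidHom.range_eq_top.2 h.2
  rwa [Monoid.Coprod.range_lift, Subgroup.range_subtype, Subgroup.range_subtype] at this

/-- Right translation on the first coordinate of `F × ℤ`. -/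
def rightTranslation (F : Type*) [Group F] : F →* Equiv.Perm (F × ℤ) where
  toFun s :=
    { toFun := fun p => (p.1 * s⁻¹, p.2)
      invFun := fun p => (p.1 * s, p.2)
      left_inv := fun p => by simp
      right_inv := fun p => by simp }
  map_one' := by ext p <;> simp
  map_mul' s t := by ext p <;> simp [mul_assoc]

open Classical in
/-- The permutation of `F × ℤ` that moves the fibre over `1` up by one. -/
noncomputable def shiftAtOne (F : Type*) [Group F] : Equiv.Perm (F × ℤ) where
  toFun p := (p.1, p.2 + if p.1 = 1 then 1 else 0)
  invFun p := (p.1, p.2 - if p.1 = 1 then 1 else 0)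
  left_inv p := by simp
  right_inv p := by simp

open Classical in
/-- A free product carries a function that is right invariant under the first factor and becomes
right invariant under the second factor after a change of its value at `1`: up to sign, the
indicator function of the elements whose normal form starts in the second factor. -/
theorem IsInternalFreeProduct.exists_invariant {F₁ F₂ : Subgroup F}
    (h : IsInternalFreeProduct F₁ F₂) :
    ∃ P : F → ℤ, P 1 = 0 ∧ (∀ g, ∀ s ∈ F₁, P (g * s) = P g) ∧
      ∀ g, ∀ s ∈ F₂, P (g * s) - (if g * s = 1 then 1 else 0) = P g - if g = 1 then 1 else 0 := by
  let e : Monoid.Coprod F₁ F₂ ≃* F := MulEquiv.ofBijective _ h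
  -- The universal property replaces normal forms: `F₁` acts by translation and `F₂` by translation
  -- conjugated by the shift at `1`. The point that `g⁻¹` makes of `(1, 0)` lies over `g`, and its
  -- height is `P g`.
  let Φ₀ : Monoid.Coprod F₁ F₂ →* Equiv.Perm (F × ℤ) :=
    Monoid.Coprod.lift ((rightTranslation F).comp F₁.subtype)
      (((MulAut.conj (shiftAtOne F)).toMonoidHom.comp (rightTranslation F)).comp F₂.subtype)
  have he₁ : ∀ s : F₁, e (Monoid.Coprod.inl s) = s := fun _ => rfl
  have he₂ : ∀ s : F₂, e (Monoid.Coprod.inr s) = s := fun _ => rfl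
  have hΦ₁ : ∀ (s : F₁) p, Φ₀ (Monoid.Coprod.inl s) p = (p.1 * (s : F)⁻¹, p.2) := fun s p => by
    simp [Φ₀, rightTranslation]
  have hΦ₂ : ∀ (s : F₂) p, Φ₀ (Monoid.Coprod.inr s) p =
      (p.1 * (s : F)⁻¹, p.2 - (if p.1 = 1 then 1 else 0) +
        if p.1 * (s : F)⁻¹ = 1 then 1 else 0) := fun s p => by
    have : (shiftAtOne F)⁻¹ p = (p.1, p.2 - if p.1 = 1 then 1 else 0) := rfl
    simp only [Φ₀, Monoid.Coprod.lift_apply_inr, MonoidHom.comp_apply, MulEquiv.coe_toMonoidHom,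
      MulAut.conj_apply, Equiv.Perm.mul_apply, this]
    rfl
  have hfst : ∀ y p, (Φ₀ y p).1 = p.1 * (e y)⁻¹ := by
    intro y
    induction y using Monoid.Coprod.induction_on with
    | inl s => intro p; rw [hΦ₁, he₁]
    | inr s => intro p; rw [hΦ₂, he₂]
    | mul a b ha hb =>
      intro p
      rw [map_mul, Equiv.Perm.mul_apply, ha, hb, map_mul, mul_inv_rev, mul_assoc]
  let P : F → ℤ := fun g => (Φ₀ (e.symm g⁻¹) (1, 0)).2
  have hP : ∀ g, Φ₀ (e.symm g⁻¹) (1, 0) = (g, P g) := fun g =>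
    Prod.ext (by rw [hfst]; simp) rfl
  refine ⟨P, by simp only [P, inv_one, map_one, Equiv.Perm.one_apply], fun g s hs => ?_, fun g s hs => ?_⟩
  · have h1 : e.symm (g * s)⁻¹ = Monoid.Coprod.inl (⟨s, hs⟩⁻¹ : F₁) * e.symm g⁻¹ := by
      rw [MulEquiv.symm_apply_eq, map_mul, he₁]; simp
    have := hP (g * s)
    rw [h1, map_mul, Equiv.Perm.mul_apply, hP, hΦ₁] at this
    exact (congrArg Prod.snd this).symm
  · have h1 : e.symm (g * s)⁻¹ = Monoid.Coprod.inr (⟨s, hs⟩⁻¹ : F₂) * e.symm g⁻¹ := by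
      rw [MulEquiv.symm_apply_eq, map_mul, he₂]; simp
    have := hP (g * s)
    rw [h1, map_mul, Equiv.Perm.mul_apply, hP, hΦ₂] at this
    have := congrArg Prod.snd this
    simp only [Subgroup.coe_inv, inv_inv] at this
    lia

theorem zpow_injective_of_ne_one {G : Type*} [Group G] [IsMulTorsionFree G] {a : G} (ha : a ≠ 1) :
    Function.Injective fun n : ℤ => a ^ n :=
  injective_zpow_iff_not_isOfFinOrder.2 (not_isOfFinOrder_of_isMulTorsionFree ha)

theorem Subgroup.infinite_coe_of_ne_bot [IsMulTorsionFree F] {H : Subgroup F} (h : H ≠ ⊥) :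
    (H : Set F).Infinite := by
  obtain ⟨a, ha, ha1⟩ := H.ne_bot_iff_exists_ne_one.1 h |>.elim fun a ha =>
    (⟨a, a.2, fun h => ha (Subtype.ext h)⟩ : ∃ a ∈ H, a ≠ 1)
  exact Set.infinite_of_injective_forall_mem (zpow_injective_of_ne_one ha1)
    fun n => H.zpow_mem ha n

open Filter in
/-- For a free product of torsion-free groups there is a function that is almost right invariant,
not almost constant, and eventually constant, with the same value at both ends, on the translates
of all cyclic groups that are conjugate into a factor. -/
theorem IsInternalFreeProduct.exists_almostInvariant [IsMulTorsionFree F] {F₁ F₂ : Subgroup F}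
    (h : IsInternalFreeProduct F₁ F₂) (h₁ : F₁ ≠ ⊥) (h₂ : F₂ ≠ ⊥) :
    ∃ P : F → ℤ, (∀ s, ∀ᶠ g in cofinite, P (g * s) = P g) ∧
      (∀ c, ¬ ∀ᶠ g in cofinite, P g = c) ∧
      ∀ a, (a ∈ F₁ ∨ a ∈ F₂) → a ≠ 1 → ∀ g k, ∃ c, ∀ᶠ n : ℤ in cofinite,
        P (g * (k * a * k⁻¹) ^ n) = c := by
  classical
  obtain ⟨P, hP1, hP₁, hP₂⟩ := h.exists_invariant
  have hne : ∀ y : F, ∀ᶠ g in cofinite, g ≠ y := fun y => by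
    simp [eventually_cofinite]
  have hmul : ∀ y : F, Tendsto (fun g => g * y) cofinite cofinite := fun y =>
    (mul_left_injective y).tendsto_cofinite
  have hinv : ∀ s, ∀ᶠ g in cofinite, P (g * s) = P g := by
    intro s
    have hs : s ∈ Subgroup.closure ((F₁ : Set F) ∪ F₂) := by
      rw [Subgroup.closure_union, Subgroup.closure_eq, Subgroup.closure_eq, h.sup_eq_top]
      trivial
    induction hs using Subgroup.closure_induction with
    | mem s hs =>
      rcases hs with hs | hs
      · exact Eventually.of_forall fun g => hP₁ g s hs
      · filter_upwards [hne 1, (hmul s).eventually (hne 1)] with g h1 h2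
        simpa [h1, h2] using hP₂ g s hs
    | one => simp
    | mul a b _ _ ha hb =>
      filter_upwards [ha, (hmul a).eventually hb] with g h1 h2
      rw [← mul_assoc, h2, h1]
    | inv a _ ha =>
      filter_upwards [(hmul a⁻¹).eventually ha] with g h1
      rw [← h1]; simp
  refine ⟨P, hinv, fun c hc => ?_, fun a ha ha1 g k => ?_⟩
  -- On `F₁` the function is `P 1 = 0`; on `F₂` without `1` it is `-1`. Both sets are infinite, so
  -- no single value is almost constant.
  · have hc0 : c = 0 := by
      obtain ⟨s, hs, hs'⟩ :=
        ((Subgroup.infinite_coe_of_ne_bot h₁).sdiff (eventually_cofinite.1 hc)).nonempty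
      have := hP₁ 1 s hs
      rw [one_mul, hP1] at this
      rw [← this]
      exact (not_not.1 hs').symm
    have hc1 : c = -1 := by
      obtain ⟨s, hs, hs'⟩ :=
        ((Subgroup.infinite_coe_of_ne_bot h₂).sdiff
          ((eventually_cofinite.1 hc).union (Set.finite_singleton 1))).nonempty
      have := hP₂ 1 s hs
      simp only [Set.mem_union, Set.mem_ofPred_eq, Set.mem_singleton_iff, not_or, not_not] at hs'
      rw [one_mul, hP1, if_neg hs'.2, if_pos rfl, hs'.1] at this
      lia
    lia
  -- Dropping the final `k⁻¹` changes only finitely many values, and the points `g * k * a ^ n` lie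
  -- in one left coset of a factor.
  · have hinj : Function.Injective fun n : ℤ => g * k * a ^ n :=
      (mul_right_injective (g * k)).comp (zpow_injective_of_ne_one ha1)
    have hk := hinj.tendsto_cofinite.eventually (hinv k⁻¹)
    have heq : ∀ n : ℤ, g * (k * a * k⁻¹) ^ n = g * k * a ^ n * k⁻¹ := fun n => by
      rw [conj_zpow]; group
    simp only [heq]
    rcases ha with ha | ha
    · refine ⟨P (g * k), ?_⟩
      filter_upwards [hk] with n hn
      rw [hn, hP₁ _ _ (F₁.zpow_mem ha n)]
    · refine ⟨P (g * k) - if g * k = 1 then 1 else 0, ?_⟩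
      filter_upwards [hk, hinj.tendsto_cofinite.eventually (hne 1)] with n hn h1
      rw [hn, ← hP₂ _ _ (F₂.zpow_mem ha n), if_neg h1, sub_zero]

end FreeProduct

/-! ### Cyclically reduced words -/

section CyclicWords

open FreeGroup

variable {α : Type*}

theorem FreeGroup.IsCyclicallyReduced.append_comm {L₁ L₂ : List (α × Bool)}
    (h : IsCyclicallyReduced (L₁ ++ L₂)) : IsCyclicallyReduced (L₂ ++ L₁) := by
  rcases eq_or_ne L₁ [] with rfl | h₁
  · simpa using h
  rcases eq_or_ne L₂ [] with rfl | h₂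
  · simpa using h
  obtain ⟨hr, hc⟩ := h
  obtain ⟨c₁, c₂, c₃⟩ := List.isChain_append.1 hr
  rw [List.getLast?_append_of_ne_nil _ h₂, List.head?_append_of_ne_nil _ h₁] at hc
  refine ⟨List.isChain_append.2 ⟨c₂, c₁, hc⟩, ?_⟩
  rw [List.getLast?_append_of_ne_nil _ h₁, List.head?_append_of_ne_nil _ h₂]
  exact c₃

theorem FreeGroup.IsCyclicallyReduced.rotate {L : List (α × Bool)}
    (h : IsCyclicallyReduced L) (n : ℕ) : IsCyclicallyReduced (L.rotate n) := by
  rw [List.rotate_eq_drop_append_take_mod]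
  apply IsCyclicallyReduced.append_comm
  rwa [List.take_append_drop]

theorem FreeGroup.isConj_mk_rotate (L : List (α × Bool)) (n : ℕ) :
    IsConj (mk L) (mk (L.rotate n)) := by
  rw [List.rotate_eq_drop_append_take_mod]
  nth_rewrite 1 [← List.take_append_drop (n % L.length) L]
  rw [← mul_mk, ← mul_mk]
  exact isConj_iff.2 ⟨(mk (L.take (n % L.length)))⁻¹, by group⟩

theorem FreeGroup.IsCyclicallyReduced.invRev {L : List (α × Bool)}
    (h : IsCyclicallyReduced L) : IsCyclicallyReduced (invRev L) := by
  obtain ⟨h₁, h₂⟩ := h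
  constructor
  · rw [FreeGroup.invRev, FreeGroup.IsReduced, List.isChain_reverse, List.isChain_map]
    exact h₁.imp fun a b hab hba => by simpa using (hab hba.symm).symm
  · intro a ha b hb hab
    simp only [FreeGroup.invRev, List.getLast?_reverse, List.head?_reverse, List.head?_map,
      List.getLast?_map, Option.mem_def, Option.map_eq_some_iff] at ha hb
    obtain ⟨a, ha, rfl⟩ := ha
    obtain ⟨b, hb, rfl⟩ := hb
    simpa using (h₂ b hb a ha hab.symm).symm

/-- Cyclically consecutive letters are the last and the first letter of a rotation. -/
theorem List.exists_rotate_of_mem_zip {β : Type*} {L : List β} {u v : β}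
    (h : (u, v) ∈ L.zip (L.rotate 1)) :
    ∃ n, (L.rotate n).head? = some v ∧ (L.rotate n).getLast? = some u := by
  obtain ⟨i, hi, he⟩ := List.mem_iff_getElem.1 h
  simp only [List.length_zip, List.length_rotate, min_self] at hi
  rw [List.getElem_zip, List.getElem_rotate, Prod.mk.injEq] at he
  refine ⟨i + 1, ?_, ?_⟩
  · rw [List.head?_eq_getElem?, List.getElem?_eq_getElem (by simp; omega), List.getElem_rotate,
      ← he.2]
    simp
  · rw [List.getLast?_eq_getElem?, List.getElem?_eq_getElem (by simp; omega), List.getElem_rotate,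
      ← he.1]
    have : ((L.rotate (i + 1)).length - 1 + (i + 1)) % L.length = i := by
      rw [List.length_rotate, show L.length - 1 + (i + 1) = i + L.length by omega,
        Nat.add_mod_right, Nat.mod_eq_of_lt hi]
    simp only [this]

theorem List.exists_mem_zip_rotate_left {β : Type*} {L : List β} {u : β} (h : u ∈ L) :
    ∃ v, (u, v) ∈ L.zip (L.rotate 1) := by
  have : u ∈ (L.zip (L.rotate 1)).map Prod.fst := by
    rwa [List.map_fst_zip (by simp)]
  obtain ⟨⟨a, b⟩, h1, rfl⟩ := List.mem_map.1 this
  exact ⟨b, h1⟩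

theorem List.exists_mem_zip_rotate_right {β : Type*} {L : List β} {v : β} (h : v ∈ L) :
    ∃ u, (u, v) ∈ L.zip (L.rotate 1) := by
  have : v ∈ (L.zip (L.rotate 1)).map Prod.snd := by
    rwa [List.map_snd_zip (by simp), List.mem_rotate]
  obtain ⟨⟨a, b⟩, h1, rfl⟩ := List.mem_map.1 this
  exact ⟨a, h1⟩

theorem List.forall_or_forall_not_of_zip_rotate {β : Type*} {L : List β} {p : β → Prop}
    (h : ∀ q ∈ L.zip (L.rotate 1), (p q.1 ↔ p q.2)) :
    (∀ a ∈ L, p a) ∨ ∀ a ∈ L, ¬ p a := by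
  have key : ∀ i (hi : i < L.length), (p (L[i]) ↔ p (L[0])) := by
    intro i
    induction i with
    | zero => intro _; rfl
    | succ i ih =>
      intro hi
      rw [← ih (by omega)]
      have hz : i < (L.zip (L.rotate 1)).length := by simp; omega
      have := h _ (List.getElem_mem hz)
      rw [List.getElem_zip, List.getElem_rotate] at this
      simp only [Nat.mod_eq_of_lt hi] at this
      exact this.symm
  by_cases h0 : ∃ a ∈ L, p a
  · left
    obtain ⟨a, ha, hpa⟩ := h0
    obtain ⟨i, hi, rfl⟩ := List.mem_iff_getElem.1 ha
    intro b hb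
    obtain ⟨j, hj, rfl⟩ := List.mem_iff_getElem.1 hb
    exact (key j hj).2 ((key i hi).1 hpa)
  · right
    push Not at h0
    exact h0

/-- The cyclically reduced length is the least norm in the conjugacy class. -/
theorem FreeGroup.length_reduceCyclically_le_norm [DecidableEq α] {g y : FreeGroup α}
    (h : IsConj y g) : (reduceCyclically g.toWord).length ≤ y.norm := by
  obtain ⟨k, hk⟩ := isConj_iff.1 h
  -- Compare the growth of powers: `n` times the cyclic length is at most `(g ^ n).norm`, which is
  -- at most `n * y.norm + 2 * k.norm`. Any `n > 2 * k.norm` then decides.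
  have hpow : ∀ n : ℕ, (y ^ n).norm ≤ n * y.norm := by
    intro n
    induction n with
    | zero => simp
    | succ n ih =>
      rw [pow_succ, Nat.succ_mul]
      exact (norm_mul_le _ _).trans (by omega)
  have hub : ∀ n : ℕ, (g ^ n).norm ≤ n * y.norm + 2 * k.norm := by
    intro n
    rw [← hk, conj_pow]
    have h1 := norm_mul_le (k * y ^ n) k⁻¹
    have h2 := norm_mul_le k (y ^ n)
    have h3 := hpow n
    rw [norm_inv_eq] at h1
    omega
  have hlb : ∀ n : ℕ, n * (reduceCyclically g.toWord).length ≤ (g ^ n).norm := by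
    intro n
    rw [norm, toWord_pow, reduceCyclically.reduce_flatten_replicate isReduced_toWord]
    split_ifs with hn
    · simp [hn]
    · simp [invRev_length]
      omega
  by_contra! hlt
  have h1 := (hlb (2 * k.norm + 1)).trans (hub (2 * k.norm + 1))
  nlinarith

variable {F ι : Type*} [Group F]

theorem cyclicWord_isCyclicallyReduced (B : FreeGroupBasis ι F) (x : F) :
    IsCyclicallyReduced (cyclicWord B x) := by
  classical
  exact reduceCyclically.isCyclicallyReduced isReduced_toWord

theorem isConj_mk_cyclicWord (B : FreeGroupBasis ι F) (x : F) :
    IsConj (mk (cyclicWord B x)) (B.repr x) := by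
  classical
  refine isConj_iff.2 ⟨mk (reduceCyclically.conjugator (B.repr x).toWord), ?_⟩
  rw [inv_mk, mul_mk, mul_mk, cyclicWord]
  convert mk_toWord (x := B.repr x) using 2
  convert reduceCyclically.conj_conjugator_reduceCyclically _

theorem cyclicWord_length_le_norm [DecidableEq ι] (B : FreeGroupBasis ι F) {x : F}
    {y : FreeGroup ι} (h : IsConj y (B.repr x)) : (cyclicWord B x).length ≤ y.norm := by
  convert length_reduceCyclically_le_norm h
  rw [cyclicWord]
  congr!

end CyclicWords

/-! ### Whitehead moves -/

section WhiteheadMove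

open FreeGroup

variable {ι : Type*}

/-- Cyclic regrouping of the product of the elements `(p a)⁻¹ * m a * q a`. -/
theorem List.prod_map_mul_eq_prod_zip {G β : Type*} [Group G] (p m q : β → G) (a c : β)
    (T : List β) :
    ((a :: T).map fun w => (p w)⁻¹ * m w * q w).prod * (p c)⁻¹ =
      (p a)⁻¹ * (((a :: T).zip (T ++ [c])).map fun r => m r.1 * (q r.1 * (p r.2)⁻¹)).prod := by
  induction T generalizing a with
  | nil => simp [mul_assoc]
  | cons b T ih =>
    have h := ih b
    rw [List.map_cons, List.prod_cons, mul_assoc, h]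
    simp [mul_assoc]

/-- Up to conjugation, the product can be cut inside the letters instead of between them, giving one
factor per pair of consecutive letters, that is, per edge of the Whitehead graph. -/
theorem List.isConj_prod_zip_rotate {G β : Type*} [Group G] (p m q : β → G) (L : List β) :
    IsConj (((L.zip (L.rotate 1)).map fun r => m r.1 * (q r.1 * (p r.2)⁻¹)).prod)
      ((L.map fun w => (p w)⁻¹ * m w * q w).prod) := by
  cases L with
  | nil => simp
  | cons a T =>
    have h := List.prod_map_mul_eq_prod_zip p m q a a T
    refine isConj_iff.2 ⟨(p a)⁻¹, ?_⟩
    rw [List.rotate_cons_succ, List.rotate_zero, ← h]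
    simp

theorem List.sum_map_fst_zip_rotate {β : Type*} (L : List β) (f : β → ℕ) :
    ((L.zip (L.rotate 1)).map fun r => f r.1).sum = (L.map f).sum := by
  have h : (L.zip (L.rotate 1)).map Prod.fst = L := List.map_fst_zip (by simp)
  conv_rhs => rw [← h, List.map_map]
  rfl

theorem List.sum_map_snd_zip_rotate {β : Type*} (L : List β) (f : β → ℕ) :
    ((L.zip (L.rotate 1)).map fun r => f r.2).sum = (L.map f).sum := by
  have h : (L.zip (L.rotate 1)).map Prod.snd = L.rotate 1 := List.map_snd_zip (by simp)
  rw [← ((List.rotate_perm L 1).map f).sum_eq]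
  conv_rhs => rw [← h, List.map_map]
  rfl

theorem FreeGroup.norm_list_prod_le [DecidableEq ι] (l : List (FreeGroup ι)) :
    l.prod.norm ≤ (l.map norm).sum := by
  induction l with
  | nil => simp
  | cons a l ih =>
    rw [List.prod_cons, List.map_cons, List.sum_cons]
    exact (FreeGroup.norm_mul_le _ _).trans (by omega)

open Classical in
/-- The power of the letter `v` that a Whitehead move attaches to the letter `w`. -/
noncomputable def whiteheadFactor (v : ι × Bool) (A : Set (ι × Bool)) (w : ι × Bool) :
    FreeGroup ι :=
  if w ∈ A then mk [v] else 1

open Classical in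
/-- The middle part of the image of the letter `w` under a Whitehead move with multiplier `v`. -/
noncomputable def whiteheadMiddle (v : ι × Bool) (w : ι × Bool) : FreeGroup ι :=
  if w.1 = v.1 then 1 else mk [w]

/-- The endomorphism underlying a Whitehead move. -/
noncomputable def whiteheadHom (v : ι × Bool) (A : Set (ι × Bool)) : FreeGroup ι →* FreeGroup ι :=
  FreeGroup.lift fun i => (whiteheadFactor v A (i, false))⁻¹ * whiteheadMiddle v (i, true) *
    whiteheadFactor v A (i, true)

open Classical in
/-- The inverse of `whiteheadHom`. -/
noncomputable def whiteheadInvHom (v : ι × Bool) (A : Set (ι × Bool)) :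
    FreeGroup ι →* FreeGroup ι :=
  FreeGroup.lift fun i => if i = v.1 then of i else
    whiteheadFactor v A (i, false) * of i * (whiteheadFactor v A (i, true))⁻¹

/-- Inversion exchanges the two attached factors, so one formula serves both signs. It also covers
the multiplier, whose middle part is trivial because the factor attached to `v ∈ A` already supplies
`v`. -/
theorem whiteheadHom_letter (v : ι × Bool) (A : Set (ι × Bool)) (w : ι × Bool) :
    whiteheadHom v A (mk [w]) = (whiteheadFactor v A (w.1, !w.2))⁻¹ * whiteheadMiddle v w *
      whiteheadFactor v A w := by
  obtain ⟨i, b⟩ := w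
  cases b with
  | true => simp [whiteheadHom, FreeGroup.lift_mk]
  | false =>
    have : (whiteheadMiddle v (i, true))⁻¹ = whiteheadMiddle v (i, false) := by
      unfold whiteheadMiddle
      split_ifs <;> simp [inv_mk, invRev]
    simp [whiteheadHom, FreeGroup.lift_mk, ← this, mul_assoc]

theorem whiteheadHom_multiplier {v : ι × Bool} {A : Set (ι × Bool)} (hv : v ∈ A)
    (hv' : (v.1, !v.2) ∉ A) : whiteheadHom v A (mk [v]) = mk [v] := by
  simp [whiteheadHom_letter, whiteheadFactor, whiteheadMiddle, hv, hv']

theorem whiteheadInvHom_multiplier (v : ι × Bool) (A : Set (ι × Bool)) :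
    whiteheadInvHom v A (mk [v]) = mk [v] := by
  obtain ⟨i, b⟩ := v
  cases b <;> simp [whiteheadInvHom, FreeGroup.lift_mk, FreeGroup.of, inv_mk, invRev]

theorem map_of_fst_eq {v : ι × Bool} {φ : FreeGroup ι →* FreeGroup ι}
    (h : φ (mk [v]) = mk [v]) : φ (of v.1) = of v.1 := by
  obtain ⟨i, b⟩ := v
  cases b with
  | true => exact h
  | false =>
    have : (mk [(i, false)] : FreeGroup ι) = (of i)⁻¹ := by simp [FreeGroup.of, inv_mk, invRev]
    rw [this, _root_.map_inv, inv_inj] at h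
    exact h

theorem map_whiteheadFactor {v : ι × Bool} {φ : FreeGroup ι →* FreeGroup ι}
    (h : φ (mk [v]) = mk [v]) (A : Set (ι × Bool)) (w : ι × Bool) :
    φ (whiteheadFactor v A w) = whiteheadFactor v A w := by
  unfold whiteheadFactor
  split_ifs
  · exact h
  · exact _root_.map_one φ

/-- The Whitehead automorphism with multiplier `v` and cut `A`. -/
noncomputable def whiteheadAut (v : ι × Bool) (A : Set (ι × Bool)) (hv : v ∈ A)
    (hv' : (v.1, !v.2) ∉ A) : FreeGroup ι ≃* FreeGroup ι :=
  MonoidHom.toMulEquiv (whiteheadHom v A) (whiteheadInvHom v A)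
    (by
      ext i
      have hI := whiteheadInvHom_multiplier v A
      have hH := whiteheadHom_multiplier hv hv'
      rw [MonoidHom.comp_apply, MonoidHom.id_apply]
      by_cases h : i = v.1
      · rw [h, map_of_fst_eq hH, map_of_fst_eq hI]
      · rw [whiteheadHom, FreeGroup.lift_apply_of, _root_.map_mul, _root_.map_mul, _root_.map_inv,
          map_whiteheadFactor hI, map_whiteheadFactor hI]
        simp only [whiteheadMiddle, if_neg h]
        change _ * whiteheadInvHom v A (of i) * _ = _
        rw [whiteheadInvHom, FreeGroup.lift_apply_of, if_neg h]
        group)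
    (by
      ext i
      have hI := whiteheadInvHom_multiplier v A
      have hH := whiteheadHom_multiplier hv hv'
      rw [MonoidHom.comp_apply, MonoidHom.id_apply]
      by_cases h : i = v.1
      · rw [h, map_of_fst_eq hI, map_of_fst_eq hH]
      · rw [whiteheadInvHom, FreeGroup.lift_apply_of, if_neg h, _root_.map_mul, _root_.map_mul, _root_.map_inv,
          map_whiteheadFactor hH, map_whiteheadFactor hH, whiteheadHom, FreeGroup.lift_apply_of]
        simp only [whiteheadMiddle, if_neg h]
        change _ * (_ * of i * _) * _ = _
        group)

theorem FreeGroup.mk_eq_prod_map (L : List (ι × Bool)) : mk L = (L.map fun w => mk [w]).prod := by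
  induction L with
  | nil => rfl
  | cons a L ih => rw [List.map_cons, List.prod_cons, ← ih, mul_mk]; rfl

/-- If the only consecutive letters separated by `A` are at `v`, and some consecutive letters at `v`
are not separated by `A`, then the Whitehead move along `A` shortens the word. -/
theorem exists_shorter_basis {F : Type*} [Group F] (B : FreeGroupBasis ι F) (x : F)
    {v : ι × Bool} {A : Set (ι × Bool)} (hv : v ∈ A) (hv' : (v.1, !v.2) ∉ A)
    (h₁ : ∀ r ∈ (cyclicWord B x).zip ((cyclicWord B x).rotate 1),
      (r.1 ∈ A ↔ (r.2.1, !r.2.2) ∈ A) ∨ r.1 = v ∨ (r.2.1, !r.2.2) = v)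
    (h₂ : ∃ r ∈ (cyclicWord B x).zip ((cyclicWord B x).rotate 1),
      (r.1 ∈ A ↔ (r.2.1, !r.2.2) ∈ A) ∧ (r.1 = v ∨ (r.2.1, !r.2.2) = v)) :
    ∃ B' : FreeGroupBasis ι F, (cyclicWord B' x).length < (cyclicWord B x).length := by
  classical
  let B' : FreeGroupBasis ι F := ⟨B.repr.trans (whiteheadAut v A hv hv')⟩
  refine ⟨B', ?_⟩
  set W := cyclicWord B x with hW
  let y : FreeGroup ι := ((W.zip (W.rotate 1)).map fun r => whiteheadMiddle v r.1 *
    (whiteheadFactor v A r.1 * (whiteheadFactor v A (r.2.1, !r.2.2))⁻¹)).prod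
  have hy : IsConj y (B'.repr x) := by
    have h1 : IsConj y (whiteheadHom v A (mk W)) := by
      rw [mk_eq_prod_map W, map_list_prod, List.map_map]
      have := List.isConj_prod_zip_rotate (fun w => whiteheadFactor v A (w.1, !w.2))
        (whiteheadMiddle v) (whiteheadFactor v A) W
      simpa only [Function.comp_def, whiteheadHom_letter] using this
    exact h1.trans (MonoidHom.map_isConj (whiteheadHom v A) (isConj_mk_cyclicWord B x))
  refine (cyclicWord_length_le_norm B' hy).trans_lt ?_
  refine (norm_list_prod_le _).trans_lt ?_
  rw [List.map_map]
  -- The old length, distributed over the edges: `c₁` counts letters other than `v` and `v⁻¹`, while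
  -- `c₂` and `c₃` count occurrences of `v` and `v⁻¹`, each charged to an edge at `v`.
  let c₁ : (ι × Bool) × (ι × Bool) → ℕ := fun r => if r.1.1 = v.1 then 0 else 1
  let c₂ : (ι × Bool) × (ι × Bool) → ℕ := fun r => if r.1 = v then 1 else 0
  let c₃ : (ι × Bool) × (ι × Bool) → ℕ := fun r => if r.2 = (v.1, !v.2) then 1 else 0
  have hsum : ((W.zip (W.rotate 1)).map fun r => c₁ r + c₂ r + c₃ r).sum = W.length := by
    rw [List.sum_map_add, List.sum_map_add]
    have e₁ := List.sum_map_fst_zip_rotate W fun a => if a.1 = v.1 then 0 else 1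
    have e₂ := List.sum_map_fst_zip_rotate W fun a => if a = v then 1 else 0
    have e₃ := List.sum_map_snd_zip_rotate W fun a => if a = (v.1, !v.2) then 1 else 0
    rw [e₁, e₂, e₃, ← List.sum_map_add, ← List.sum_map_add]
    have : (fun a : ι × Bool => ((if a.1 = v.1 then 0 else 1) + (if a = v then 1 else 0) +
        (if a = (v.1, !v.2) then 1 else 0) : ℕ)) = fun _ => 1 := by
      funext ⟨i, b⟩
      obtain ⟨j, d⟩ := v
      by_cases hij : i = j
      · cases b <;> cases d <;> simp [hij]
      · simp [hij]
    rw [this]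
    simp
  rw [← hsum]
  -- Across an edge not cut by `A` the two attached factors cancel.
  have hbound : ∀ r : (ι × Bool) × (ι × Bool), (whiteheadMiddle v r.1 *
      (whiteheadFactor v A r.1 * (whiteheadFactor v A (r.2.1, !r.2.2))⁻¹)).norm ≤
      c₁ r + if (r.1 ∈ A ↔ (r.2.1, !r.2.2) ∈ A) then 0 else 1 := by
    intro r
    refine (FreeGroup.norm_mul_le _ _).trans (Nat.add_le_add ?_ ?_)
    · simp only [whiteheadMiddle, c₁]
      split_ifs
      · simp
      · exact norm_mk_le
    · have : (mk [v]).norm ≤ 1 := norm_mk_le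
      simp only [whiteheadFactor]
      by_cases ha : r.1 ∈ A <;> by_cases hb : (r.2.1, !r.2.2) ∈ A <;>
        simp only [ha, hb, if_true, if_false, inv_one, mul_one, one_mul, mul_inv_cancel, FreeGroup.norm_one,
          norm_inv_eq, iff_self, iff_true, iff_false, not_true_eq_false] <;> omega
  have hflip : ∀ w : ι × Bool, (w.1, !w.2) = v ↔ w = (v.1, !v.2) := by
    rintro ⟨i, b⟩
    obtain ⟨j, d⟩ := v
    cases b <;> cases d <;> simp
  simp only [hflip] at h₁ h₂
  refine List.sum_lt_sum _ _ (fun r hr => (hbound r).trans ?_) ?_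
  · have := h₁ r hr
    simp only [c₂, c₃]
    rcases this with h | h | h
    · rw [if_pos h]; omega
    · rw [if_pos h]; split_ifs <;> omega
    · rw [if_pos h]; split_ifs <;> omega
  · obtain ⟨r, hr, hA, hor⟩ := h₂
    refine ⟨r, hr, (hbound r).trans_lt ?_⟩
    simp only [c₂, c₃, if_pos hA]
    rcases hor with h | h
    · rw [if_pos h]; omega
    · rw [if_pos h]; omega

end WhiteheadMove

/-! ### Cut vertices and almost invariant functions -/

section CutVertex

variable {V : Type*} {G : SimpleGraph V}

theorem SimpleGraph.Preconnected.apply_eq_of_adj {γ : Type*} (hG : G.Preconnected) {d : V → γ}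
    (hd : ∀ a b, G.Adj a b → d a = d b) (a b : V) : d a = d b := by
  obtain ⟨p⟩ := hG a b
  induction p with
  | nil => rfl
  | cons h _ ih => exact (hd _ _ h).trans ih

theorem SimpleGraph.preconnected_of_subsingleton_connectedComponent
    (h : Subsingleton G.ConnectedComponent) : G.Preconnected := fun a b =>
  ConnectedComponent.exact (Subsingleton.elim (G.connectedComponentMk a) (G.connectedComponentMk b))

theorem SimpleGraph.Preconnected.induce_compl_of_not_isCutVertex (hG : G.Preconnected) {v : V}
    (hv : ¬ IsCutVertex G v) : (G.induce {v}ᶜ).Preconnected := by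
  apply preconnected_of_subsingleton_connectedComponent
  rw [← Cardinal.le_one_iff_subsingleton]
  exact (not_lt.1 hv).trans
    (Cardinal.le_one_iff_subsingleton.2 hG.subsingleton_connectedComponent)

theorem IsCutVertex.not_preconnected_induce_compl {v : V} (hv : IsCutVertex G v) :
    ¬ (G.induce {v}ᶜ).Preconnected := fun h => by
  have h1 : Cardinal.mk (G.induce {v}ᶜ).ConnectedComponent ≤ 1 :=
    Cardinal.le_one_iff_subsingleton.2 h.subsingleton_connectedComponent
  have h2 : 1 ≤ Cardinal.mk G.ConnectedComponent :=
    Cardinal.one_le_iff_ne_zero.2 (Cardinal.mk_ne_zero_iff.2 ⟨G.connectedComponentMk v⟩)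
  exact absurd hv (not_lt.2 (h1.trans h2))

end CutVertex

/-! ### Cones of reduced words with a common prefix -/

section Cones

open FreeGroup Filter

variable {ι : Type*}

/-- The letters `w` for which `w⁻¹` may follow the reduced word `L` span a connected subgraph. -/
theorem preconnected_induce_isReduced {G : SimpleGraph (ι × Bool)} (hG : G.Preconnected)
    (hG' : ∀ v, (G.induce {v}ᶜ).Preconnected) {L : List (ι × Bool)} (hL : FreeGroup.IsReduced L) :
    (G.induce {w | FreeGroup.IsReduced (L ++ [(w.1, !w.2)])}).Preconnected := by
  rcases L.eq_nil_or_concat with rfl | ⟨L, a, rfl⟩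
  · have : {w : ι × Bool | FreeGroup.IsReduced ([] ++ [(w.1, !w.2)])} = Set.univ := by
      ext w; simp
    rw [this]
    exact (SimpleGraph.induceUnivIso G).preconnected_iff.2 hG
  · rw [List.concat_eq_append] at hL ⊢
    -- After a last letter `a` only `a⁻¹` is forbidden, so the single vertex `a` is removed.
    have : {w : ι × Bool | FreeGroup.IsReduced (L ++ [a] ++ [(w.1, !w.2)])} = {a}ᶜ := by
      ext ⟨i, b⟩
      obtain ⟨j, c⟩ := a
      simp only [FreeGroup.IsReduced, Set.mem_ofPred_eq] at hL ⊢
      rw [List.isChain_append]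
      simp only [hL, true_and, List.isChain_singleton]
      by_cases h : i = j
      · cases b <;> cases c <;> simp [h]
      · simp [h, Ne.symm h]
    rw [this]
    exact hG' a

/-- Nothing cancels: `L ++ [b]` and the power of `R` are reduced and overlap in `b`. -/
theorem FreeGroup.prefix_toWord_mul_pow [DecidableEq ι] {L R : List (ι × Bool)} {b : ι × Bool}
    (hR : IsCyclicallyReduced R) (hb : R.head? = some b) (hL : FreeGroup.IsReduced (L ++ [b]))
    {n : ℕ} (hn : n ≠ 0) : L ++ [b] <+: (mk L * mk R ^ n).toWord := by
  have hhead : (List.replicate n R).flatten.head? = some b := by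
    rw [List.head?_flatten_replicate hn, hb]
  obtain ⟨T, hT⟩ : ∃ T, (List.replicate n R).flatten = b :: T := List.head?_eq_some_iff.1 hhead
  have hred : FreeGroup.IsReduced (L ++ (List.replicate n R).flatten) := by
    have h1 := (hR.flatten_replicate n).isReduced
    rw [hT] at h1 ⊢
    have := IsReduced.append_overlap (L₁ := L) (L₂ := [b]) (L₃ := T) hL (by simpa using h1)
      (by simp)
    simpa using this
  rw [pow_mk, mul_mk, toWord_mk, hred.reduce_eq, hT]
  exact ⟨T, by simp⟩

/-- Along a line in a cone, an almost constant function on the cone tends to its almost constant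
value. -/
theorem FreeGroup.eq_of_eventually_cone [DecidableEq ι] {γ : Type*} {P : FreeGroup ι → γ}
    {L R : List (ι × Bool)} {b : ι × Bool} {c c' : γ}
    (hR : IsCyclicallyReduced R) (hb : R.head? = some b) (hL : FreeGroup.IsReduced (L ++ [b]))
    (hc : ∀ᶠ h in cofinite, L ++ [b] <+: h.toWord → P h = c)
    (hc' : ∀ᶠ n : ℤ in cofinite, P (mk L * mk R ^ n) = c') : c = c' := by
  have hne : mk R ≠ 1 := by
    intro h
    have := congrArg toWord h
    rw [toWord_mk, hR.isReduced.reduce_eq, toWord_one] at this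
    simp [this] at hb
  have hinj : Function.Injective fun n : ℤ => mk L * mk R ^ n :=
    (mul_right_injective (mk L)).comp (zpow_injective_of_ne_one hne)
  have hnat := Nat.cast_injective (R := ℤ) |>.tendsto_cofinite
  have h1 := hnat.eventually (hinj.tendsto_cofinite.eventually hc)
  have h2 := hnat.eventually hc'
  rw [Nat.cofinite_eq_atTop] at h1 h2
  obtain ⟨n, h1, h2, hn⟩ := (h1.and (h2.and (eventually_ge_atTop 1))).exists
  rw [zpow_natCast] at h1 h2
  rw [← h1 (prefix_toWord_mul_pow hR hb hL (by omega)), h2]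

variable {F : Type*} [Group F]

theorem mem_zip_of_whiteheadGraph_adj {B : FreeGroupBasis ι F} {x : F} {a b : ι × Bool}
    (h : (whiteheadGraph B x).Adj a b) :
    (a, (b.1, !b.2)) ∈ (cyclicWord B x).zip ((cyclicWord B x).rotate 1) ∨
      (b, (a.1, !a.2)) ∈ (cyclicWord B x).zip ((cyclicWord B x).rotate 1) :=
  ((SimpleGraph.fromRel_adj _ _ _).1 h).2

theorem whiteheadGraph_adj_of_mem_zip {B : FreeGroupBasis ι F} {x : F}
    {r : (ι × Bool) × (ι × Bool)}
    (h : r ∈ (cyclicWord B x).zip ((cyclicWord B x).rotate 1)) (hne : r.1 ≠ (r.2.1, !r.2.2)) :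
    (whiteheadGraph B x).Adj r.1 (r.2.1, !r.2.2) :=
  (SimpleGraph.fromRel_adj _ _ _).2 ⟨hne, Or.inl (by simpa using h)⟩

/-- If the Whitehead graph is connected and has no cut vertex, then an almost invariant function
that has the same value at both ends of each axis of a conjugate of `x` is almost constant. -/
theorem exists_eventually_eq_of_preconnected [Finite ι] {γ : Type*} [Nonempty γ]
    (B : FreeGroupBasis ι F) (x : F)
    (hG : (whiteheadGraph B x).Preconnected)
    (hG' : ∀ v, ((whiteheadGraph B x).induce {v}ᶜ).Preconnected)
    {P : FreeGroup ι → γ} (hP : ∀ s, ∀ᶠ g in cofinite, P (g * s) = P g)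
    (hline : ∀ g m, ∃ c, ∀ᶠ n : ℤ in cofinite, P (g * mk ((cyclicWord B x).rotate m) ^ n) = c) :
    ∃ c, ∀ᶠ g in cofinite, P g = c := by
  classical
  set W := cyclicWord B x with hW
  have hWr : IsCyclicallyReduced W := cyclicWord_isCyclicallyReduced B x
  obtain ⟨N, hN⟩ : ∃ N : ℕ, ∀ g : FreeGroup ι, N ≤ g.norm → ∀ a, P (g * mk [a]) = P g := by
    have h1 : ∀ᶠ g in cofinite, ∀ a : ι × Bool, P (g * mk [a]) = P g :=
      eventually_all.2 fun a => hP (mk [a])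
    obtain ⟨M, hM⟩ := ((eventually_cofinite.1 h1).image FreeGroup.norm).bddAbove
    refine ⟨M + 1, fun g hg => ?_⟩
    by_contra hcon
    have := hM ⟨g, hcon, rfl⟩
    omega
  -- Here `k` bounds how far `L` falls short of length `N`. At `k = 0` every element of the cone is
  -- reached from `mk L` by appending letters, none of which changes `P`.
  have key : ∀ (k : ℕ) (L : List (ι × Bool)), FreeGroup.IsReduced L → N ≤ L.length + k →
      ∃ c, ∀ᶠ h in cofinite, L <+: h.toWord → P h = c := by
    intro k
    induction k with
    | zero =>
      intro L hL hk
      have hT : ∀ T, FreeGroup.IsReduced (L ++ T) → P (mk (L ++ T)) = P (mk L) := by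
        intro T
        induction T using List.reverseRecOn with
        | nil => simp
        | append_singleton T a ih =>
          intro hred
          rw [← List.append_assoc] at hred ⊢
          have hred' : FreeGroup.IsReduced (L ++ T) := hred.infix ⟨[], [a], by simp⟩
          rw [← mul_mk, hN, ih hred']
          rw [FreeGroup.norm, toWord_mk, hred'.reduce_eq, List.length_append]
          omega
      refine ⟨P (mk L), Eventually.of_forall ?_⟩
      rintro h ⟨T, hh⟩
      have := hT T (hh ▸ isReduced_toWord)
      rwa [hh, mk_toWord] at this
    | succ k ih =>
      intro L hL hk
      have hcol : ∀ a, FreeGroup.IsReduced (L ++ [a]) →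
          ∃ c, ∀ᶠ h in cofinite, L ++ [a] <+: h.toWord → P h = c := fun a ha =>
        ih (L ++ [a]) ha (by simp; omega)
      let s : Set (ι × Bool) := {w | FreeGroup.IsReduced (L ++ [(w.1, !w.2)])}
      have hs : ((whiteheadGraph B x).induce s).Preconnected :=
        preconnected_induce_isReduced hG hG' hL
      choose d hd using fun w : s => hcol _ w.2
      -- Some rotation `R` of `W` starts with `b⁻¹` and ends with `a`. The line `L * R ^ n` enters
      -- the cone of `L b⁻¹` as `n → ∞` and that of `L a⁻¹` as `n → -∞`.
      have hpair : ∀ a b : s, (a.1, (b.1.1, !b.1.2)) ∈ W.zip (W.rotate 1) → d a = d b := by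
        intro a b hab
        obtain ⟨m, hm1, hm2⟩ := List.exists_rotate_of_mem_zip hab
        obtain ⟨c, hc⟩ := hline (mk L) m
        have hR := hWr.rotate m
        have hb : d b = c := eq_of_eventually_cone hR hm1 b.2 (hd b) hc
        have hinv : (invRev (W.rotate m)).head? = some (a.1.1, !a.1.2) := by
          rw [invRev, List.head?_reverse, List.getLast?_map, hm2]; rfl
        have hc' : ∀ᶠ n : ℤ in cofinite, P (mk L * mk (invRev (W.rotate m)) ^ n) = c := by
          filter_upwards [(neg_injective (G := ℤ)).tendsto_cofinite.eventually hc] with n hn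
          rw [← inv_mk, inv_zpow', hn]
        have ha : d a = c := eq_of_eventually_cone hR.invRev hinv a.2 (hd a) hc'
        rw [ha, hb]
      have hconst := hs.apply_eq_of_adj (d := d) fun a b hab => by
        rcases mem_zip_of_whiteheadGraph_adj (SimpleGraph.comap_adj.1 hab) with h | h
        · exact hpair a b h
        · exact (hpair b a h).symm
      obtain ⟨c, hc⟩ : ∃ c, ∀ w, d w = c := by
        by_cases hne : Nonempty s
        · exact ⟨d hne.some, fun w => hconst _ _⟩
        · exact ⟨Classical.arbitrary γ, fun w => absurd ⟨w⟩ hne⟩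
      have hall : ∀ᶠ h in cofinite, ∀ w : s, L ++ [(w.1.1, !w.1.2)] <+: h.toWord → P h = c :=
        eventually_all.2 fun w => by simpa only [hc] using hd w
      -- The cone of `L` is the union of its subcones and the one element `mk L`.
      have hne : ∀ᶠ h in cofinite, h ≠ mk L := by simp [eventually_cofinite]
      refine ⟨c, ?_⟩
      filter_upwards [hall, hne] with h h1 h2
      rintro ⟨T, hT⟩
      cases T with
      | nil =>
        refine absurd ?_ h2
        rw [← mk_toWord (x := h), ← hT, List.append_nil]
      | cons a T =>
        have hpre : L ++ [a] <+: h.toWord := ⟨T, by rw [← hT]; simp⟩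
        have hred : FreeGroup.IsReduced (L ++ [a]) := isReduced_toWord.infix hpre.isInfix
        refine h1 ⟨(a.1, !a.2), ?_⟩ ?_
        · simpa [s] using hred
        · simpa using hpre
  obtain ⟨c, hc⟩ := key N [] IsReduced.nil (by simp)
  exact ⟨c, hc.mono fun h hh => hh (List.nil_prefix)⟩

end Cones

/-! ### Whitehead's cut vertex criterion -/

section Main

open FreeGroup Filter

theorem FreeGroupBasis.ne_bot_of_mem {F ι : Type*} [Group F] (B : FreeGroupBasis ι F) {S : Set ι}
    {i : ι} (hi : i ∈ S) : Subgroup.closure (B '' S) ≠ ⊥ := fun h => by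
  have h1 : B i ∈ Subgroup.closure (B '' S) := Subgroup.subset_closure ⟨i, hi, rfl⟩
  rw [h, Subgroup.mem_bot] at h1
  have h2 := congrArg B.repr h1
  rw [B.repr_apply_coe, _root_.map_one] at h2
  exact of_ne_one i h2

theorem exists_conj_mem_closure {F ι : Type*} [Group F] (B : FreeGroupBasis ι F) {x : F}
    {S : Set ι} (h : ∀ w ∈ cyclicWord B x, w.1 ∈ S) :
    ∃ g : F, g * x * g⁻¹ ∈ Subgroup.closure (B '' S) := by
  obtain ⟨k, hk⟩ := isConj_iff.1 (isConj_mk_cyclicWord B x).symm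
  refine ⟨B.repr.symm k, ?_⟩
  have h1 : B.repr.symm k * x * (B.repr.symm k)⁻¹ = B.repr.symm (mk (cyclicWord B x)) := by
    rw [← hk]; simp
  rw [h1, mk_eq_prod_map, map_list_prod, List.map_map]
  refine Subgroup.list_prod_mem _ fun y hy => ?_
  obtain ⟨⟨i, b⟩, hw, rfl⟩ := List.mem_map.1 hy
  have hi : B.repr.symm (of i) ∈ Subgroup.closure (B '' S) :=
    Subgroup.subset_closure ⟨i, h _ hw, rfl⟩
  cases b with
  | true => exact hi
  | false =>
    have : (mk [(i, false)] : FreeGroup ι) = (of i)⁻¹ := by simp [FreeGroup.of, inv_mk, invRev]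
    rw [Function.comp_apply, this, _root_.map_inv]
    exact inv_mem hi

theorem isSeparableSet_of_partition {F ι : Type*} [Group F] (B : FreeGroupBasis ι F) {x : F}
    {S : Set ι} {i j : ι} (hi : i ∈ S) (hj : j ∉ S)
    (h : (∀ w ∈ cyclicWord B x, w.1 ∈ S) ∨ ∀ w ∈ cyclicWord B x, w.1 ∉ S) :
    IsSeparableSet {x} := by
  refine ⟨_, _, B.ne_bot_of_mem hi, B.ne_bot_of_mem (S := Sᶜ) hj,
    B.isInternalFreeProduct_closure S, fun a ha => ?_⟩
  obtain rfl := Finset.mem_singleton.1 ha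
  exact h.imp (exists_conj_mem_closure B) (exists_conj_mem_closure B)

theorem eq_one_of_cyclicWord_eq_nil {F ι : Type*} [Group F] {B : FreeGroupBasis ι F} {x : F}
    (h : cyclicWord B x = []) : x = 1 := by
  have := isConj_mk_cyclicWord B x
  rw [h, ← one_eq_mk, isConj_one_right] at this
  simpa using this

/-- If the Whitehead graph of a shortest word is disconnected, then the element is separable. -/
theorem isSeparableSet_of_not_preconnected {F ι : Type*} [Group F] (B : FreeGroupBasis ι F) {x : F}
    (hx : x = 1 → IsEmpty (F ≃* Multiplicative ℤ))
    (hmin : ∀ B' : FreeGroupBasis ι F, (cyclicWord B x).length ≤ (cyclicWord B' x).length)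
    (hG : ¬ (whiteheadGraph B x).Preconnected) : IsSeparableSet {x} := by
  obtain ⟨a, b, hab⟩ : ∃ a b, ¬ (whiteheadGraph B x).Reachable a b := by
    by_contra! hall
    exact hG hall
  let C : Set (ι × Bool) := {w | (whiteheadGraph B x).Reachable a w}
  have hC : ∀ r ∈ (cyclicWord B x).zip ((cyclicWord B x).rotate 1),
      (r.1 ∈ C ↔ (r.2.1, !r.2.2) ∈ C) := by
    intro r hr
    by_cases hne : r.1 = (r.2.1, !r.2.2)
    · rw [← hne]
    · have hadj := (whiteheadGraph_adj_of_mem_zip hr hne).reachable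
      exact ⟨fun h => h.trans hadj, fun h => h.trans hadj.symm⟩
  -- No edge leaves `C`. If `C` contains `v` but not `v⁻¹`, the move along `C` would erase every `v`
  -- and `v⁻¹`, so by minimality neither occurs.
  by_cases hsep : ∃ v : ι × Bool, v ∈ C ∧ (v.1, !v.2) ∉ C
  · obtain ⟨v, hv, hv'⟩ := hsep
    have hnot : ∀ w ∈ cyclicWord B x, w.1 ≠ v.1 := by
      intro w hw hwv
      have hw' : w = v ∨ w = (v.1, !v.2) := by
        obtain ⟨i, b⟩ := w
        obtain ⟨j, c⟩ := v
        obtain rfl : i = j := hwv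
        cases b <;> cases c <;> simp
      obtain ⟨B', hB'⟩ := exists_shorter_basis B x hv hv' (fun r hr => Or.inl (hC r hr)) (by
        rcases hw' with rfl | rfl
        · obtain ⟨t, ht⟩ := List.exists_mem_zip_rotate_left hw
          exact ⟨_, ht, hC _ ht, Or.inl rfl⟩
        · obtain ⟨t, ht⟩ := List.exists_mem_zip_rotate_right hw
          exact ⟨_, ht, hC _ ht, Or.inr (by simp)⟩)
      exact absurd hB' (not_lt.2 (hmin B'))
    by_cases hj : ∃ j, j ≠ v.1
    -- A second basis element makes the complement of `v.1` nonempty; without one, `F` is infinite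
    -- cyclic and the word is empty, which `hx` excludes.
    · obtain ⟨j, hj⟩ := hj
      exact isSeparableSet_of_partition B (S := {v.1}) rfl hj (Or.inr hnot)
    · push Not at hj
      have h1 : x = 1 := eq_one_of_cyclicWord_eq_nil (B := B)
        (List.eq_nil_iff_forall_not_mem.2 fun w hw => hnot w hw (hj w.1))
      have : Unique ι := ⟨⟨v.1⟩, hj⟩
      exact ((hx h1).false (B.repr.trans mulEquivIntOfUnique)).elim
  · push Not at hsep
    have hflip : ∀ w : ι × Bool, w ∈ C ↔ (w.1, true) ∈ C := by
      rintro ⟨i, b⟩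
      cases b with
      | true => rfl
      | false => exact ⟨hsep (i, false), hsep (i, true)⟩
    refine isSeparableSet_of_partition B (S := {i | (i, true) ∈ C}) (i := a.1) (j := b.1)
      ((hflip a).1 (SimpleGraph.Reachable.refl a)) (fun h => hab ((hflip b).2 h)) ?_
    -- As `C` is closed under inversion, consecutive letters lie on the same side, so the whole word
    -- does.
    refine List.forall_or_forall_not_of_zip_rotate (p := fun w : ι × Bool => (w.1, true) ∈ C) fun r hr => ?_
    have := hC r hr
    rwa [hflip r.1, hflip (r.2.1, !r.2.2)] at this

/-- A cut vertex of a connected Whitehead graph yields a shorter word. -/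
theorem exists_shorter_basis_of_isCutVertex {F ι : Type*} [Group F] (B : FreeGroupBasis ι F)
    (x : F) (hG : (whiteheadGraph B x).Preconnected) {v : ι × Bool}
    (hv : IsCutVertex (whiteheadGraph B x) v) :
    ∃ B' : FreeGroupBasis ι F, (cyclicWord B' x).length < (cyclicWord B x).length := by
  set G := whiteheadGraph B x with hGdef
  have hvv : (v.1, !v.2) ≠ v := fun h => by simpa using congrArg Prod.snd h
  let v' : ({v}ᶜ : Set (ι × Bool)) := ⟨(v.1, !v.2), hvv⟩
  obtain ⟨r, hr⟩ : ∃ r, ¬ (G.induce {v}ᶜ).Reachable v' r := by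
    by_contra! hall
    exact hv.not_preconnected_induce_compl fun p q => (hall p).symm.trans (hall q)
  let C : Set (ι × Bool) := {w | ∃ h : w ≠ v, ¬ (G.induce {v}ᶜ).Reachable v' ⟨w, h⟩}
  have hvC : v ∉ C := fun h => h.1 rfl
  have hstep : ∀ p q, G.Adj p q → p ≠ v → q ≠ v → p ∈ C → q ∈ C := by
    rintro p q hpq hp hq ⟨_, hpC⟩
    refine ⟨hq, fun hreach => hpC (hreach.trans (SimpleGraph.Adj.reachable ?_))⟩
    exact SimpleGraph.comap_adj.2 hpq.symm
  refine exists_shorter_basis B x (v := v) (A := insert v C) (Set.mem_insert _ _) ?_ ?_ ?_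
  · rintro (h | h)
    · exact hvv h
    · exact h.2 (SimpleGraph.Reachable.refl v')
  · intro t ht
    by_cases h1 : t.1 = v
    · exact Or.inr (Or.inl h1)
    by_cases h2 : (t.2.1, !t.2.2) = v
    · exact Or.inr (Or.inr h2)
    left
    by_cases hne : t.1 = (t.2.1, !t.2.2)
    · rw [← hne]
    have hadj := whiteheadGraph_adj_of_mem_zip ht hne
    simp only [Set.mem_insert_iff, h1, h2, false_or]
    exact ⟨hstep _ _ hadj h1 h2, hstep _ _ hadj.symm h2 h1⟩
  -- A path from `r` to `v` can leave `C` only by an edge to `v`; this edge at `v` is not cut by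
  -- `insert v C`.
  · obtain ⟨p⟩ := hG r.1 v
    obtain ⟨d, -, hd1, hd2⟩ := p.exists_boundary_dart C ⟨r.2, hr⟩ hvC
    have hdv : d.toProd.2 = v := by
      by_contra hne
      exact hd2 (hstep _ _ d.adj hd1.1 hne hd1)
    have hadj := d.adj
    rw [hdv] at hadj
    rcases mem_zip_of_whiteheadGraph_adj hadj with h | h
    · exact ⟨_, h, by simp [hd1], by simp⟩
    · exact ⟨_, h, by simp [hd1], by simp⟩

/-- Whitehead's cut vertex lemma. -/
theorem IsSeparableSet.not_preconnected_or_isCutVertex {F ι : Type*} [Group F] {x : F}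
    (h : IsSeparableSet {x}) (B : FreeGroupBasis ι F) :
    ¬ (whiteheadGraph B x).Preconnected ∨ ∃ v, IsCutVertex (whiteheadGraph B x) v := by
  by_contra! hcon
  obtain ⟨hG, hcut⟩ := hcon
  obtain ⟨F₁, F₂, h₁, h₂, hF, hconj⟩ := h
  have hG' := fun v => hG.induce_compl_of_not_isCutVertex (hcut v)
  have : IsMulTorsionFree F :=
    Function.Injective.isMulTorsionFree B.repr.toMonoidHom B.repr.injective
  have : Nonempty ι := by
    by_contra hne
    rw [not_nonempty_iff] at hne
    refine h₁ ((Subgroup.eq_bot_iff_forall _).2 fun y _ => B.repr.injective ?_)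
    exact Subsingleton.elim _ _
  -- Connectedness leaves no isolated vertex, so every basis element occurs in the word. This forces
  -- finite rank and `x ≠ 1`.
  have hocc : ∀ i, ∃ w ∈ cyclicWord B x, w.1 = i := by
    intro i
    obtain ⟨w, hw⟩ := hG.exists_adj_of_nontrivial (i, true)
    rcases mem_zip_of_whiteheadGraph_adj hw with hm | hm
    · exact ⟨_, (List.of_mem_zip hm).1, rfl⟩
    · exact ⟨_, List.mem_rotate.1 (List.of_mem_zip hm).2, rfl⟩
  have : Finite ι := by
    refine Set.finite_univ_iff.1 (((cyclicWord B x).map Prod.fst).finite_toSet.subset ?_)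
    intro i _
    obtain ⟨w, hw, rfl⟩ := hocc i
    exact List.mem_map_of_mem hw
  have hx1 : x ≠ 1 := by
    rintro rfl
    obtain ⟨w, hw, -⟩ := hocc (Classical.arbitrary ι)
    simp [cyclicWord] at hw
  obtain ⟨P, hinv, hnc, hline⟩ := hF.exists_almostInvariant h₁ h₂
  obtain ⟨a, ha, k, hk⟩ : ∃ a, (a ∈ F₁ ∨ a ∈ F₂) ∧ ∃ k, k * x * k⁻¹ = a := by
    rcases hconj x (Finset.mem_singleton_self x) with ⟨g, hg⟩ | ⟨g, hg⟩
    · exact ⟨_, Or.inl hg, g, rfl⟩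
    · exact ⟨_, Or.inr hg, g, rfl⟩
  have ha1 : a ≠ 1 := by
    rw [← hk, Ne, conj_eq_one_iff]; exact hx1
  have hsymm := B.repr.symm.injective.tendsto_cofinite
  obtain ⟨c, hc⟩ := exists_eventually_eq_of_preconnected B x hG hG' (P := fun g => P (B.repr.symm g))
    (fun s => by simpa using hsymm.eventually (hinv (B.repr.symm s))) (fun g m => by
      have hconj' : IsConj a (B.repr.symm (mk ((cyclicWord B x).rotate m))) := by
        have h1 : IsConj (B.repr x) (mk ((cyclicWord B x).rotate m)) :=
          (isConj_mk_cyclicWord B x).symm.trans (isConj_mk_rotate _ m)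
        have h2 := B.repr.symm.toMonoidHom.map_isConj h1
        have h3 : IsConj x a := isConj_iff.2 ⟨k, hk⟩
        refine h3.symm.trans ?_
        simpa using h2
      obtain ⟨l, hl⟩ := isConj_iff.1 hconj'
      obtain ⟨c, hc⟩ := hline a ha ha1 (B.repr.symm g) l
      refine ⟨c, ?_⟩
      simpa [← hl] using hc)
  refine hnc c ?_
  simpa using B.repr.injective.tendsto_cofinite.eventually hc

end Main

theorem corollary2 {F : Type u} [Group F] [IsFreeGroup F] (x : F)
    (hx : x = 1 → IsEmpty (F ≃* Multiplicative ℤ)) :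
    IsSeparableSet {x} ↔
      ∀ (ι : Type u) (B : FreeGroupBasis ι F),
        ¬ (whiteheadGraph B x).Preconnected ∨ ∃ v, IsCutVertex (whiteheadGraph B x) v := by
  refine ⟨fun h ι B => h.not_preconnected_or_isCutVertex B, fun h => ?_⟩
  let ι := IsFreeGroup.Generators F
  obtain ⟨B, -, hB⟩ := WellFounded.has_min
    (measure fun B : FreeGroupBasis ι F => (cyclicWord B x).length).wf Set.univ
    ⟨IsFreeGroup.basis F, trivial⟩
  have hmin : ∀ B' : FreeGroupBasis ι F, (cyclicWord B x).length ≤ (cyclicWord B' x).length :=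
    fun B' => not_lt.1 (hB B' trivial)
  by_cases hG : (whiteheadGraph B x).Preconnected
  · obtain ⟨v, hv⟩ := (h ι B).resolve_left (not_not.2 hG)
    obtain ⟨B', hB'⟩ := exists_shorter_basis_of_isCutVertex B x hG hv
    exact absurd hB' (not_lt.2 (hmin B'))
  · exact isSeparableSet_of_not_preconnected B hx hmin hG
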